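/- Let $g:\mathbb{R}^n\to(-\infty,\infty]$ be proper, lower semicontinuous and convex, where $\mathbb{R}^n$ carries the Euclidean norm. For $x\in\mathbb{R}^n$ with $g(x)<\infty$ put $\partial g(x)=\{v:\langle v,y-x\rangle\le g(y)-g(x)\ \text{for all } y\in\mathbb{R}^n\}$, and put $\partial g(x)=\emptyset$ if $g(x)=\infty$. For $\lambda>0$ let $$e_\lambda g(x)=\inf_{y}\Big\{g(y)+\tfrac1{2\lambda}\|y-x\|^2\Big\},\qquad \mathrm{Prox}_{\lambda g}(x)=\operatorname*{argmin}_{y}\Big\{g(y)+\tfrac1{2\lambda}\|y-x\|^2\Big\}$$ be the Moreau envelope and the proximal mapping of $g$. The gradient-based inexact proximal point method (GIPPM) is the following. Choose $\lambda>0$, an initial point $x^0\in\mathbb{R}^n$, an initial error $\varepsilon_0>0$, $\theta\in(0,1)$ and $\mu>2$. For $k=0,1,2,\dots$, find $p^k$ and the smallest $i_k\in\{0,1,2,\dots\}$ such that $$\|p^k-\mathrm{Prox}_{\lambda g}(x^k)\|\le\lambda\theta^{i_k}\varepsilon_k\quad\text{and}\quad\|x^k-p^k\|>\lambda\mu\theta^{i_k}\varepsilon_k,$$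 and set $x^{k+1}:=p^k$, $\varepsilon_{k+1}:=\theta^{i_k}\varepsilon_k$. Here "smallest" means that trial points $q$ with $\|q-\mathrm{Prox}_{\lambda g}(x^k)\|\le\lambda\theta^{j}\varepsilon_k$ are computed for $j=0,1,2,\dots$ until one of them satisfies $\|x^k-q\|>\lambda\mu\theta^{j}\varepsilon_k$; that $j$ is $i_k$ and that $q$ is $p^k$. A differentiable function $f:\mathbb{R}^n\to\mathbb{R}$ satisfies the KL property at $\bar x$ with $\psi$ if for some $\eta>0$ and some neighborhood $U$ of $\bar x$ the function $\psi:(0,\eta)\to(0,\infty)$ is nondecreasing, $1/\psi$ is integrable over $(0,\eta)$, and $\|\nabla f(x)\|\ge\psi(f(x)-f(\bar x))$ for all $x\in U$ with $f(\bar x)<f(x)<f(\bar x)+\eta$. It satisfies the KL property at $\bar x$ if it does so with some $\psi$. **Theorem.** Let $\{x^k\}$, $\{p^k\}$, $\{\varepsilon_k\}$ be generated by GIPPM, and assume that $0\notin\partial g(x^k)$ for all $k$. Then either $\|x^k\|\to\infty$ as $k\to\infty$, or all of the following hold. 1. Every accumulation point of $\{x^k\}$ is a minimizer of $g$, and both $\|x^k-p^k\|$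 and $\varepsilon_k$ converge to $0$ as $k\to\infty$. 2. If $e_\lambda g$ satisfies the KL property at an accumulation point $\bar x$ of $\{x^k\}$, then $x^k\to\bar x$ as $k\to\infty$. 3. If $e_\lambda g$ satisfies the KL property at an accumulation point $\bar x$ of $\{x^k\}$ with $\psi(t)=Mt^q$ for some $M>0$ and $q\in(0,1)$, then: - for $q\in(0,1/2]$, the sequence $\{x^k\}$ converges linearly to $\bar x$, that is, $\|x^k-\bar x\|\le Cc^k$ for all $k$ with some constants $C$ and $c\in(0,1)$; - for $q\in(1/2,1)$, $\|x^k-\bar x\|=\mathcal{O}\big(k^{-\frac{1-q}{2q-1}}\big)$ as $k\to\infty$. -/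

import Mathlib

open Filter Topology Asymptotics MeasureTheory

namespace GIPPM

/-- The space `ℝⁿ` with its Euclidean norm and inner product. -/
abbrev E (n : ℕ) : Type := EuclideanSpace ℝ (Fin n)

/-- `g : ℝⁿ → (-∞, ∞]` is proper: it never takes the value `-∞` and is finite somewhere. -/
def Proper {n : ℕ} (g : E n → EReal) : Prop :=
  (∀ x, g x ≠ ⊥) ∧ ∃ x, g x ≠ ⊤

/-- Convexity of an extended-real-valued function (for functions that never take the value `-∞`,
so that no sum `∞ - ∞` occurs). -/
def ConvexFun {n : ℕ} (g : E n → EReal) : Prop :=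
  ∀ x y : E n, ∀ t : ℝ, 0 < t → t < 1 →
    g ((1 - t) • x + t • y) ≤ ((1 - t : ℝ) : EReal) * g x + (t : EReal) * g y

/-- The convex subdifferential `∂g(x)`; it is empty when `x` is not in the domain of `g`. -/
def subdifferential {n : ℕ} (g : E n → EReal) (x : E n) : Set (E n) :=
  {v | g x < ⊤ ∧ ∀ y : E n, ((inner ℝ v (y - x) : ℝ) : EReal) ≤ g y - g x}

/-- The function `y ↦ g(y) + ‖y - x‖² / (2λ)` that defines the envelope and the proximal map. -/
noncomputable def proxObjective {n : ℕ} (lam : ℝ) (g : E n → EReal) (x y : E n) : EReal :=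
  g y + ((1 / (2 * lam) * ‖y - x‖ ^ 2 : ℝ) : EReal)

/-- The Moreau envelope `e_λ g`. The infimum is taken in `[-∞, ∞]`; it is a real number whenever
`g` is proper, lower semicontinuous and convex and `0 < λ`. -/
noncomputable def moreauEnvelope {n : ℕ} (lam : ℝ) (g : E n → EReal) (x : E n) : ℝ :=
  (⨅ y : E n, proxObjective lam g x y).toReal

/-- The proximal mapping `Prox_{λ g}(x)`, as the set of all minimizers of
`y ↦ g(y) + ‖y - x‖² / (2λ)`. It is a singleton whenever `g` is proper, lower semicontinuous and
convex and `0 < λ`. -/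
def proxSet {n : ℕ} (lam : ℝ) (g : E n → EReal) (x : E n) : Set (E n) :=
  {z | ∀ y : E n, proxObjective lam g x z ≤ proxObjective lam g x y}

/-- `‖p - Prox_{λ g}(x)‖ ≤ δ`. -/
def ApproxProx {n : ℕ} (lam : ℝ) (g : E n → EReal) (x p : E n) (δ : ℝ) : Prop :=
  ∃ z ∈ proxSet lam g x, ‖p - z‖ ≤ δ

/-- The sequences `x` (iterates), `p` (inexact proximal points), `ε` (errors) and `i` (numbers of
error reductions) are generated by the gradient-based inexact proximal point method with proximal
parameter `lam`, error reduction factor `θ` and scaling factor `μ`. The sequences are indexed from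
`0`, so that `x 0` is the initial point and `ε 0` is the initial error.

In step `k` trial points with proximal error at most `lam * θ ^ j * ε k` are computed for
`j = 0, 1, 2, …`, and `i k` is the first `j` whose trial point is at a distance larger than
`lam * μ * θ ^ j * ε k` from `x k`; that trial point is `p k`. In `not_accepted`, `q` is the
rejected trial point of round `j`. -/
structure IsGenerated {n : ℕ} (g : E n → EReal) (lam θ μ : ℝ)
    (x p : ℕ → E n) (ε : ℕ → ℝ) (i : ℕ → ℕ) : Prop where
  approx : ∀ k, ApproxProx lam g (x k) (p k) (lam * θ ^ i k * ε k)
  accepted : ∀ k, ‖x k - p k‖ > lam * μ * θ ^ i k * ε k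
  not_accepted : ∀ k, ∀ j < i k, ∃ q : E n,
    ApproxProx lam g (x k) q (lam * θ ^ j * ε k) ∧ ‖x k - q‖ ≤ lam * μ * θ ^ j * ε k
  iterate_update : ∀ k, x (k + 1) = p k
  error_update : ∀ k, ε (k + 1) = θ ^ i k * ε k

/-- The differentiable function `f` satisfies the Kurdyka-Łojasiewicz property at `xbar` with the
function `ψ` (only the values of `ψ` on some interval `(0, η)` matter). -/
def KLPropertyWith {n : ℕ} (f : E n → ℝ) (xbar : E n) (ψ : ℝ → ℝ) : Prop :=
  ∃ η : ℝ, 0 < η ∧ ∃ U ∈ 𝓝 xbar,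
    (∀ t ∈ Set.Ioo 0 η, 0 < ψ t) ∧
    MonotoneOn ψ (Set.Ioo 0 η) ∧
    IntegrableOn (fun t => 1 / ψ t) (Set.Ioo 0 η) ∧
    ∀ x ∈ U, f xbar < f x → f x < f xbar + η → ψ (f x - f xbar) ≤ ‖gradient f x‖

/-- The differentiable function `f` satisfies the Kurdyka-Łojasiewicz property at `xbar`. -/
def KLProperty {n : ℕ} (f : E n → ℝ) (xbar : E n) : Prop :=
  ∃ ψ : ℝ → ℝ, KLPropertyWith f xbar ψ

/-- Linear (that is, R-linear) convergence of `x` to `xbar`. -/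
def ConvergesLinearly {n : ℕ} (x : ℕ → E n) (xbar : E n) : Prop :=
  ∃ c : ℝ, 0 < c ∧ c < 1 ∧ ∃ C : ℝ, ∀ k, ‖x k - xbar‖ ≤ C * c ^ k

end GIPPM

/-! The method is an inexact gradient descent with step `lam` on the Moreau envelope `e`, since
`∇e(x) = (x - Prox x) / lam`. The acceptance test makes the proximal error at most `1 / μ` times the
step `d = x (k+1) - x k`. As `1 / μ < 1 / 2`, `e` decreases by at least a multiple of `‖d‖ ^ 2`, and
`‖∇e(x k)‖ ≤ (2 / lam) ‖d‖` (`IsGenerated.descent`).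

If `‖x k‖` does not tend to infinity, there is a cluster point. Then `e (x k)` is bounded below, so
the steps vanish, and the subgradient inequality at the proximal points passes to the limit
(`IsGenerated.isMinimizer`).

Under KL, dividing the decrease of the gap `Δ k = e (x k) - e xbar` by `ψ (Δ k)` bounds each step by
a telescoping difference of `φ (Δ k)`, with `φ` a primitive of `1 / ψ`
(`eventually_dist_le_of_desingularized`). For `ψ t = M t ^ q`, `Δ k - Δ (k+1)` dominates a multiple
of `Δ k ^ (2q)`, and `‖x k - xbar‖ = O(Δ k ^ (1 - q))`; the rates follow. -/

namespace GIPPM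

/-! ### Subgradients, quadratic bounds and the gradient of the Moreau envelope -/

section Envelope

variable {n : ℕ} {g : E n → EReal} {lam : ℝ} {x z : E n}

/-- The value of `g` at a proximal point is finite, and the scaled displacement is a subgradient. -/
lemma exists_subgradient_of_mem_proxSet (hg : Proper g) (hc : ConvexFun g) (hlam : 0 < lam)
    (hz : z ∈ proxSet lam g x) :
    ∃ a : ℝ, g z = a ∧
      ∀ w, ∀ b : ℝ, g w = b → a + inner ℝ ((1 / lam) • (x - z)) (w - z) ≤ b := by
  obtain ⟨hbot, w₀, hw₀⟩ := hg
  have htop : g z ≠ ⊤ := by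
    intro h
    have h1 := hz w₀
    lift g w₀ to ℝ using ⟨hw₀, hbot w₀⟩ with b hb
    rw [proxObjective, proxObjective, h, ← hb, EReal.top_add_coe, ← EReal.coe_add] at h1
    exact absurd h1 (not_le.2 (EReal.coe_lt_top _))
  refine ⟨(g z).toReal, (EReal.coe_toReal htop (hbot z)).symm, ?_⟩
  intro w b hb
  set a := (g z).toReal with ha
  have hza : g z = a := (EReal.coe_toReal htop (hbot z)).symm
  -- Compare `z` with a point of the segment towards `w`; after division by `t`, the quadratic
  -- remainder vanishes as `t → 0`.
  have key : ∀ t : ℝ, 0 < t → t < 1 →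
      a + inner ℝ ((1 / lam) • (x - z)) (w - z) ≤ b + t * (1 / (2 * lam) * ‖w - z‖ ^ 2) := by
    intro t ht ht1
    have h1 := hc z w t ht ht1
    have h2 := hz ((1 - t) • z + t • w)
    rw [hza, hb, ← EReal.coe_mul, ← EReal.coe_mul, ← EReal.coe_add] at h1
    have h3 : (a : EReal) + ((1 / (2 * lam) * ‖z - x‖ ^ 2 : ℝ) : EReal) ≤
        (((1 - t) * a + t * b : ℝ) : EReal) +
          ((1 / (2 * lam) * ‖(1 - t) • z + t • w - x‖ ^ 2 : ℝ) : EReal) := by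
      rw [← hza]
      exact h2.trans (add_le_add h1 le_rfl)
    rw [← EReal.coe_add, ← EReal.coe_add, EReal.coe_le_coe_iff] at h3
    have h4 : (1 - t) • z + t • w - x = (z - x) + t • (w - z) := by
      module
    have h5 : ‖(1 - t) • z + t • w - x‖ ^ 2 =
        ‖z - x‖ ^ 2 + 2 * t * inner ℝ (z - x) (w - z) + t ^ 2 * ‖w - z‖ ^ 2 := by
      rw [h4, norm_add_sq_real, inner_smul_right, norm_smul, mul_pow, Real.norm_eq_abs, sq_abs]
      ring
    have h6 : inner ℝ ((1 / lam) • (x - z)) (w - z) = -(1 / lam * inner ℝ (z - x) (w - z)) := by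
      rw [inner_smul_left, ← neg_sub z x, inner_neg_left]
      simp
    rw [h5] at h3
    rw [h6]
    have h7 : t * (a - 1 / lam * inner ℝ (z - x) (w - z)) ≤
        t * (b + t * (1 / (2 * lam) * ‖w - z‖ ^ 2)) := by
      have h8 : 1 / (2 * lam) * 2 = 1 / lam := by field_simp
      rw [← h8]
      nlinarith
    have := le_of_mul_le_mul_left h7 ht
    linarith
  have hcont : Continuous fun t : ℝ => b + t * (1 / (2 * lam) * ‖w - z‖ ^ 2) := by fun_prop
  have hlim := hcont.tendsto 0
  simp only [zero_mul, add_zero] at hlim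
  refine ge_of_tendsto (hlim.mono_left (nhdsWithin_le_nhds (s := Set.Ioi 0))) ?_
  filter_upwards [Ioo_mem_nhdsGT (zero_lt_one (α := ℝ))] with t ht
  exact key t ht.1 ht.2

/-- Completing the square: the two sides differ by `‖u + lam • v‖ ^ 2 / (2 * lam)`. -/
lemma linear_add_sq_ge {F : Type*} [NormedAddCommGroup F] [InnerProductSpace ℝ F]
    (hlam : 0 < lam) (v u : F) :
    -(lam / 2 * ‖v‖ ^ 2) ≤ inner ℝ v u + 1 / (2 * lam) * ‖u‖ ^ 2 := by
  have h1 : 0 ≤ ‖u + lam • v‖ ^ 2 := sq_nonneg _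
  rw [norm_add_sq_real, inner_smul_right, norm_smul, mul_pow, Real.norm_eq_abs, sq_abs,
    real_inner_comm] at h1
  have h2 : inner ℝ v u + 1 / (2 * lam) * ‖u‖ ^ 2 + lam / 2 * ‖v‖ ^ 2 =
      1 / (2 * lam) * (‖u‖ ^ 2 + 2 * (lam * inner ℝ v u) + lam ^ 2 * ‖v‖ ^ 2) := by
    field_simp
    ring
  have h3 : 0 ≤ 1 / (2 * lam) * (‖u‖ ^ 2 + 2 * (lam * inner ℝ v u) + lam ^ 2 * ‖v‖ ^ 2) :=
    mul_nonneg (by positivity) h1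
  linarith

/-- If `g` has an affine minorant, its envelope at `y` is the greatest lower bound of the
finite values of the proximal objective. -/
lemma moreauEnvelope_isGLB (hg : Proper g) (hlam : 0 < lam) {v : E n} {a : ℝ}
    (hv : ∀ w, ∀ b : ℝ, g w = b → a + inner ℝ v (w - z) ≤ b) (y : E n) :
    (∀ w, ∀ b : ℝ, g w = b → moreauEnvelope lam g y ≤ b + 1 / (2 * lam) * ‖w - y‖ ^ 2) ∧
    ∀ c : ℝ, (∀ w, ∀ b : ℝ, g w = b → c ≤ b + 1 / (2 * lam) * ‖w - y‖ ^ 2) →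
      c ≤ moreauEnvelope lam g y := by
  obtain ⟨hbot, w₀, hw₀⟩ := hg
  have low : ∀ c : ℝ, (∀ w, ∀ b : ℝ, g w = b → c ≤ b + 1 / (2 * lam) * ‖w - y‖ ^ 2) →
      (c : EReal) ≤ ⨅ w : E n, proxObjective lam g y w := by
    intro c h
    refine le_iInf fun w => ?_
    by_cases hw : g w = ⊤
    · rw [proxObjective, hw, EReal.top_add_coe]; exact le_top
    · have h1 := (EReal.coe_toReal hw (hbot w)).symm
      rw [proxObjective, h1, ← EReal.coe_add, EReal.coe_le_coe_iff]
      exact h w _ h1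
  have up : ∀ w, ∀ b : ℝ, g w = b →
      ⨅ w : E n, proxObjective lam g y w ≤ ((b + 1 / (2 * lam) * ‖w - y‖ ^ 2 : ℝ) : EReal) := by
    intro w b hb
    refine (iInf_le _ w).trans ?_
    rw [proxObjective, hb, ← EReal.coe_add]
  -- The affine minorant excludes `⊥`, so that `toReal` does not return its default value.
  have hnb : ⨅ w : E n, proxObjective lam g y w ≠ ⊥ := by
    have := low (a + inner ℝ v (y - z) - lam / 2 * ‖v‖ ^ 2) ?_
    · exact ne_bot_of_le_ne_bot (EReal.coe_ne_bot _) this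
    · intro w b hb
      have h1 := hv w b hb
      have h2 := linear_add_sq_ge hlam v (w - y)
      have h3 : inner ℝ v (w - z) = inner ℝ v (y - z) + inner ℝ v (w - y) := by
        rw [← inner_add_right]; congr 1; abel
      linarith
  have hnt : ⨅ w : E n, proxObjective lam g y w ≠ ⊤ :=
    ne_top_of_le_ne_top (EReal.coe_ne_top _) (up w₀ _ (EReal.coe_toReal hw₀ (hbot w₀)).symm)
  have hr := EReal.coe_toReal hnt hnb
  refine ⟨fun w b hb => ?_, fun c h => ?_⟩
  · have := up w b hb
    rw [← hr, EReal.coe_le_coe_iff] at this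
    exact this
  · have := low c h
    rw [← hr, EReal.coe_le_coe_iff] at this
    exact this

/-- Quadratic bounds on the Moreau envelope at a point with a known proximal point. -/
lemma moreauEnvelope_bounds (hg : Proper g) (hc : ConvexFun g) (hlam : 0 < lam)
    (hz : z ∈ proxSet lam g x) (y : E n) :
    moreauEnvelope lam g x + inner ℝ ((1 / lam) • (x - z)) (y - x) ≤ moreauEnvelope lam g y ∧
    moreauEnvelope lam g y ≤ moreauEnvelope lam g x + inner ℝ ((1 / lam) • (x - z)) (y - x) +
      1 / (2 * lam) * ‖y - x‖ ^ 2 := by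
  obtain ⟨a, ha, hv⟩ := exists_subgradient_of_mem_proxSet hg hc hlam hz
  set v := (1 / lam) • (x - z) with hvdef
  have hxz : x - z = lam • v := by
    rw [hvdef, smul_smul, mul_one_div_cancel hlam.ne', one_smul]
  -- The affine minorant of `g` at `z` yields one of the envelope with the same slope; `up` tests
  -- the infimum at `z`. At `y' = x` the two bounds coincide and give the value of the envelope
  -- there.
  have low : ∀ y' : E n, a + inner ℝ v (y' - x) + lam / 2 * ‖v‖ ^ 2 ≤ moreauEnvelope lam g y' := by
    intro y'
    refine (moreauEnvelope_isGLB hg hlam hv y').2 _ fun w b hb => ?_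
    have h1 := hv w b hb
    have h2 := linear_add_sq_ge hlam v (w - y')
    have h3 : inner ℝ v (w - z) =
        inner ℝ v (w - y') + inner ℝ v (y' - x) + lam * ‖v‖ ^ 2 := by
      rw [show w - z = (w - y') + (y' - x) + (x - z) by abel, inner_add_right, inner_add_right,
        hxz, inner_smul_right, real_inner_self_eq_norm_sq]
    linarith
  have up : ∀ y' : E n, moreauEnvelope lam g y' ≤
      a + inner ℝ v (y' - x) + 1 / (2 * lam) * ‖y' - x‖ ^ 2 + lam / 2 * ‖v‖ ^ 2 := by
    intro y'
    refine ((moreauEnvelope_isGLB hg hlam hv y').1 z a ha).trans (le_of_eq ?_)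
    rw [norm_sub_rev, show y' - z = (y' - x) + (x - z) by abel, hxz, norm_add_sq_real,
      inner_smul_right, norm_smul, mul_pow, Real.norm_eq_abs, sq_abs, real_inner_comm]
    field_simp
    ring
  have lx := low x
  have ux := up x
  simp only [sub_self, inner_zero_right, norm_zero] at lx ux
  have ly := low y
  have uy := up y
  constructor <;> linarith

lemma hasGradientAt_moreauEnvelope (hg : Proper g) (hc : ConvexFun g) (hlam : 0 < lam)
    (hz : z ∈ proxSet lam g x) :
    HasGradientAt (moreauEnvelope lam g) ((1 / lam) • (x - z)) x := by
  rw [hasGradientAt_iff_isLittleO]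
  refine IsBigO.trans_isLittleO (g := fun y => ‖y - x‖ ^ 2) ?_
    (isLittleO_pow_sub_sub x one_lt_two)
  refine IsBigO.of_bound (1 / (2 * lam)) (Eventually.of_forall fun y => ?_)
  obtain ⟨h1, h2⟩ := moreauEnvelope_bounds hg hc hlam hz y
  have h3 : 0 ≤ 1 / (2 * lam) * ‖y - x‖ ^ 2 := by positivity
  rw [norm_pow, norm_norm, Real.norm_eq_abs, abs_le]
  constructor <;> linarith

end Envelope

/-! ### Sufficient decrease and cluster points -/

section Descent

variable {n : ℕ} {g : E n → EReal} {lam θ μ : ℝ} {x p : ℕ → E n} {ε : ℕ → ℝ} {i : ℕ → ℕ}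

lemma IsGenerated.error_pos (h : IsGenerated g lam θ μ x p ε i) (hθ : 0 < θ) (hε : 0 < ε 0)
    (k : ℕ) : 0 < ε k := by
  induction k with
  | zero => exact hε
  | succ k ih => rw [h.error_update]; positivity

/-- An iterate moves by a nonzero vector, along which the envelope decreases sufficiently, and
which controls the gradient and the error. -/
lemma IsGenerated.descent (h : IsGenerated g lam θ μ x p ε i) (hg : Proper g) (hc : ConvexFun g)
    (hlam : 0 < lam) (hθ : 0 < θ) (hμ : 2 < μ) (hε : 0 < ε 0) (k : ℕ) :
    0 < ‖x (k + 1) - x k‖ ∧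
    lam * μ * ε (k + 1) ≤ ‖x (k + 1) - x k‖ ∧
    moreauEnvelope lam g (x (k + 1)) + (1 / lam) * (1 / 2 - 1 / μ) * ‖x (k + 1) - x k‖ ^ 2 ≤
      moreauEnvelope lam g (x k) ∧
    ∃ z ∈ proxSet lam g (x k), ‖x k - z‖ ≤ 2 * ‖x (k + 1) - x k‖ := by
  obtain ⟨z, hz, hpz⟩ := h.approx k
  have hacc := h.accepted k
  have hεk := h.error_pos hθ hε (k + 1)
  rw [mul_assoc lam, ← h.error_update, ← h.iterate_update] at hpz
  rw [mul_assoc (lam * μ), ← h.error_update, ← h.iterate_update, norm_sub_rev] at hacc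
  set d := x (k + 1) - x k with hd
  have hdpos : 0 < ‖d‖ := lt_of_le_of_lt (by positivity) hacc
  have hμ0 : 0 < μ := by linarith
  have herr : ‖x (k + 1) - z‖ ≤ 1 / μ * ‖d‖ := by
    refine hpz.trans ?_
    rw [one_div, ← div_eq_inv_mul, le_div_iff₀ hμ0]
    linarith
  refine ⟨hdpos, hacc.le, ?_, z, hz, ?_⟩
  -- In units of `‖d‖ ^ 2 / lam`, the linear term contributes `-1` plus an error of at most `1 / μ`,
  -- and the quadratic term `1 / 2`.
  · have h1 := (moreauEnvelope_bounds hg hc hlam hz (x (k + 1))).2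
    rw [← hd, inner_smul_left] at h1
    have h2 : x k - z = (x (k + 1) - z) - d := by rw [hd]; abel
    rw [h2, inner_sub_left, real_inner_self_eq_norm_sq] at h1
    have h3 : inner ℝ (x (k + 1) - z) d ≤ 1 / μ * ‖d‖ * ‖d‖ :=
      (real_inner_le_norm _ _).trans (by gcongr)
    have h4 : 1 / lam * inner ℝ (x (k + 1) - z) d ≤ 1 / lam * (1 / μ * ‖d‖ * ‖d‖) := by gcongr
    have h5 : 1 / (2 * lam) = 1 / lam * (1 / 2) := by field_simp
    rw [h5] at h1
    simp only [conj_trivial] at h1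
    linarith
  · have h2 : x k - z = (x (k + 1) - z) - d := by rw [hd]; abel
    have h3 : 1 / μ ≤ 1 := by rw [div_le_one hμ0]; linarith
    rw [h2]
    calc ‖(x (k + 1) - z) - d‖ ≤ ‖x (k + 1) - z‖ + ‖d‖ := norm_sub_le _ _
      _ ≤ 1 * ‖d‖ + ‖d‖ := by gcongr; exact herr.trans (by gcongr)
      _ = 2 * ‖d‖ := by ring

lemma IsGenerated.envelope_antitone (h : IsGenerated g lam θ μ x p ε i) (hg : Proper g)
    (hc : ConvexFun g) (hlam : 0 < lam) (hθ : 0 < θ) (hμ : 2 < μ) (hε : 0 < ε 0) :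
    StrictAnti fun k => moreauEnvelope lam g (x k) := by
  refine strictAnti_nat_of_succ_lt fun k => ?_
  obtain ⟨h1, -, h2, -⟩ := h.descent hg hc hlam hθ hμ hε k
  have h3 : 1 / μ < 1 / 2 := one_div_lt_one_div_of_lt two_pos hμ
  have h4 : 0 < 1 / 2 - 1 / μ := by linarith
  have h5 : 0 < 1 / lam * (1 / 2 - 1 / μ) * ‖x (k + 1) - x k‖ ^ 2 := by positivity
  linarith

/-- The cluster point serves to bound the envelope values below: an affine minorant does so
infinitely often, and monotonicity does so always. The values then converge, and their differences
dominate the squared steps. -/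
lemma IsGenerated.tendsto_step (h : IsGenerated g lam θ μ x p ε i) (hg : Proper g)
    (hc : ConvexFun g) (hlam : 0 < lam) (hθ : 0 < θ) (hμ : 2 < μ) (hε : 0 < ε 0)
    {xbar : E n} (hxbar : MapClusterPt xbar atTop x) :
    Tendsto (fun k => ‖x (k + 1) - x k‖) atTop (𝓝 0) := by
  have hanti := h.envelope_antitone hg hc hlam hθ hμ hε
  obtain ⟨-, -, -, z, hz, -⟩ := h.descent hg hc hlam hθ hμ hε 0
  have hlow := fun y => (moreauEnvelope_bounds hg hc hlam hz y).1
  set v := (1 / lam) • (x 0 - z)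
  set c := moreauEnvelope lam g (x 0) + inner ℝ v (xbar - x 0) - 1
  have hfreq : ∃ᶠ k in atTop, c < moreauEnvelope lam g (x k) := by
    have hcont : Continuous fun y : E n => moreauEnvelope lam g (x 0) + inner ℝ v (y - x 0) := by
      fun_prop
    have : ∀ᶠ y in 𝓝 xbar, c < moreauEnvelope lam g (x 0) + inner ℝ v (y - x 0) :=
      (hcont.tendsto xbar).eventually_const_lt (by simp [c])
    exact (hxbar.frequently this).mono fun k hk => hk.trans_le (hlow _)
  have hbdd : BddBelow (Set.range fun k => moreauEnvelope lam g (x k)) := by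
    refine ⟨c, ?_⟩
    rintro _ ⟨k, rfl⟩
    obtain ⟨m, hm, hcm⟩ := (frequently_atTop.1 hfreq) k
    exact hcm.le.trans (hanti.antitone hm)
  have hlim := tendsto_atTop_ciInf hanti.antitone hbdd
  have hdiff : Tendsto (fun k => moreauEnvelope lam g (x k) - moreauEnvelope lam g (x (k + 1)))
      atTop (𝓝 0) := by
    have := hlim.sub (hlim.comp (tendsto_add_atTop_nat 1))
    simpa using this
  set β := 1 / lam * (1 / 2 - 1 / μ) with hβ
  have hβpos : 0 < β := by
    have h3 : 1 / μ < 1 / 2 := one_div_lt_one_div_of_lt two_pos hμ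
    have h4 : 0 < 1 / 2 - 1 / μ := by linarith
    positivity
  have hsq : Tendsto (fun k => ‖x (k + 1) - x k‖ ^ 2) atTop (𝓝 0) := by
    refine squeeze_zero (fun _ => by positivity) (fun k => ?_)
      (by simpa using hdiff.div_const β)
    rw [le_div_iff₀ hβpos]
    have := (h.descent hg hc hlam hθ hμ hε k).2.2.1
    rw [← hβ] at this
    linarith
  have := hsq.sqrt
  simpa [Real.sqrt_sq] using this

/-- The displacements `x k - z k` tend to zero with the steps. Hence the proximal points converge to
`xbar` along a subsequence while their subgradients vanish, and lower semicontinuity finishes. -/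
lemma IsGenerated.isMinimizer (h : IsGenerated g lam θ μ x p ε i) (hg : Proper g)
    (hlsc : LowerSemicontinuous g)
    (hc : ConvexFun g) (hlam : 0 < lam) (hθ : 0 < θ) (hμ : 2 < μ) (hε : 0 < ε 0)
    {xbar : E n} (hxbar : MapClusterPt xbar atTop x) (y : E n) : g xbar ≤ g y := by
  have hstep := h.tendsto_step hg hc hlam hθ hμ hε hxbar
  choose z hz hxz using fun k => (h.descent hg hc hlam hθ hμ hε k).2.2.2
  have hzero : Tendsto (fun k => x k - z k) atTop (𝓝 0) := by
    rw [tendsto_zero_iff_norm_tendsto_zero]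
    exact squeeze_zero (fun _ => norm_nonneg _) hxz (by simpa using hstep.const_mul 2)
  obtain ⟨s, hs, hxs⟩ := hxbar.tendsto_subseq
  have hzs : Tendsto (fun k => z (s k)) atTop (𝓝 xbar) := by
    have := hxs.sub (hzero.comp hs.tendsto_atTop)
    simpa [Function.comp_def] using this
  by_cases hy : g y = ⊤
  · rw [hy]; exact le_top
  obtain ⟨b, hb⟩ : ∃ b : ℝ, g y = b := ⟨_, (EReal.coe_toReal hy (hg.1 y)).symm⟩
  have hle : ∀ k, g (z k) ≤ ((b - inner ℝ ((1 / lam) • (x k - z k)) (y - z k) : ℝ) : EReal) := by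
    intro k
    obtain ⟨a, ha, hv⟩ := exists_subgradient_of_mem_proxSet hg hc hlam (hz k)
    rw [ha, EReal.coe_le_coe_iff]
    have := hv y b hb
    linarith
  have hlim : Tendsto
      (fun k => b - inner ℝ ((1 / lam) • (x (s k) - z (s k))) (y - z (s k))) atTop (𝓝 b) := by
    have h1 : Tendsto (fun k => (1 / lam) • (x (s k) - z (s k))) atTop (𝓝 0) := by
      simpa using (hzero.comp hs.tendsto_atTop).const_smul (1 / lam)
    have h2 : Tendsto (fun k => y - z (s k)) atTop (𝓝 (y - xbar)) := hzs.const_sub y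
    simpa using (h1.inner h2).const_sub b
  have hlimE := (continuous_coe_real_ereal.tendsto b).comp hlim
  refine le_of_forall_lt_imp_le_of_dense fun c hcx => ?_
  rw [hb]
  refine ge_of_tendsto hlimE ?_
  filter_upwards [hzs.eventually (hlsc xbar c hcx)] with k hk
  exact hk.le.trans (hle (s k))

/-- The envelope at the iterates decreases strictly to its value at a cluster point. -/
lemma IsGenerated.tendsto_envelope (h : IsGenerated g lam θ μ x p ε i) (hg : Proper g)
    (hlsc : LowerSemicontinuous g)
    (hc : ConvexFun g) (hlam : 0 < lam) (hθ : 0 < θ) (hμ : 2 < μ) (hε : 0 < ε 0)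
    {xbar : E n} (hxbar : MapClusterPt xbar atTop x) :
    (∀ k, 0 < moreauEnvelope lam g (x k) - moreauEnvelope lam g xbar) ∧
    Tendsto (fun k => moreauEnvelope lam g (x k) - moreauEnvelope lam g xbar) atTop (𝓝 0) := by
  have hmin := h.isMinimizer hg hlsc hc hlam hθ hμ hε hxbar
  have hanti := h.envelope_antitone hg hc hlam hθ hμ hε
  obtain ⟨-, -, -, z, hz, -⟩ := h.descent hg hc hlam hθ hμ hε 0
  obtain ⟨a, ha, hv⟩ := exists_subgradient_of_mem_proxSet hg hc hlam hz
  have hglb := moreauEnvelope_isGLB hg hlam hv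
  obtain ⟨b, hb⟩ : ∃ b : ℝ, g xbar = b := by
    refine ⟨_, (EReal.coe_toReal ?_ (hg.1 xbar)).symm⟩
    exact ne_top_of_le_ne_top (by rw [ha]; exact EReal.coe_ne_top a) (hmin z)
  have hge : ∀ y, b ≤ moreauEnvelope lam g y := by
    refine fun y => (hglb y).2 b fun w b' hb' => ?_
    have h1 := hmin w
    rw [hb, hb', EReal.coe_le_coe_iff] at h1
    have : 0 ≤ 1 / (2 * lam) * ‖w - y‖ ^ 2 := by positivity
    linarith
  have hle : ∀ y, moreauEnvelope lam g y ≤ b + 1 / (2 * lam) * ‖xbar - y‖ ^ 2 :=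
    fun y => (hglb y).1 xbar b hb
  have heq : moreauEnvelope lam g xbar = b := by
    refine le_antisymm ?_ (hge _)
    simpa using hle xbar
  rw [heq]
  -- The minimum bounds the next value, which is strictly smaller than the current one.
  refine ⟨fun k => sub_pos.2 ((hge (x (k + 1))).trans_lt (hanti k.lt_succ_self)), ?_⟩
  refine tendsto_order.2 ⟨fun c hc0 => Eventually.of_forall fun k =>
    hc0.trans_le (sub_nonneg.2 (hge _)), fun c hc0 => ?_⟩
  have hcont : Continuous fun y : E n => 1 / (2 * lam) * ‖xbar - y‖ ^ 2 := by fun_prop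
  have hev : ∀ᶠ y in 𝓝 xbar, 1 / (2 * lam) * ‖xbar - y‖ ^ 2 < c :=
    (hcont.tendsto xbar).eventually_lt_const (by simpa using hc0)
  obtain ⟨K, hK⟩ := (hxbar.frequently hev).exists
  filter_upwards [eventually_ge_atTop K] with k hk
  have h1 : moreauEnvelope lam g (x k) ≤ moreauEnvelope lam g (x K) := hanti.antitone hk
  have h2 := hle (x K)
  linarith

end Descent

/-! ### Desingularizing functions and scalar recursions -/

section Desingularization

/-- A sequence whose steps are controlled, near a cluster point, by the decrease of `φ (Δ k)`
converges to that point, at the rate `C * φ (Δ k)`. -/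
lemma eventually_dist_le_of_desingularized {F : Type*} [SeminormedAddCommGroup F] {x : ℕ → F}
    {xbar : F} (hxbar : MapClusterPt xbar atTop x) {Δ : ℕ → ℝ} (hΔ : ∀ k, 0 < Δ k)
    (hΔ0 : Tendsto Δ atTop (𝓝 0)) {φ : ℝ → ℝ} {η C : ℝ} (hη : 0 < η) (hC : 0 ≤ C)
    (hφ : ∀ t ∈ Set.Ioo 0 η, 0 ≤ φ t) (hφ0 : Tendsto φ (𝓝[>] 0) (𝓝 0)) {U : Set F}
    (hU : U ∈ 𝓝 xbar)
    (hstep : ∀ k, x k ∈ U → Δ k < η → Δ (k + 1) < η →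
      ‖x (k + 1) - x k‖ ≤ C * (φ (Δ k) - φ (Δ (k + 1)))) :
    Tendsto x atTop (𝓝 xbar) ∧
    ∀ᶠ k in atTop, x k ∈ U ∧ Δ k < η ∧ ‖x k - xbar‖ ≤ C * φ (Δ k) := by
  obtain ⟨r, hr, hrU⟩ := Metric.mem_nhds_iff.1 hU
  have hlim : Tendsto (fun k => C * φ (Δ k)) atTop (𝓝 0) := by
    have h1 : Tendsto Δ atTop (𝓝[>] 0) :=
      tendsto_nhdsWithin_iff.2 ⟨hΔ0, Eventually.of_forall hΔ⟩
    simpa using (hφ0.comp h1).const_mul C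
  obtain ⟨N, hN⟩ := eventually_atTop.1 ((hΔ0.eventually_lt_const hη).and
    (hlim.eventually_lt_const (half_pos hr)))
  obtain ⟨K, hK, hxK⟩ := frequently_atTop.1
    (hxbar.frequently (Metric.ball_mem_nhds xbar (half_pos hr))) N
  have hΔη : ∀ k, K ≤ k → Δ k < η := fun k hk => (hN k (hK.trans hk)).1
  have hφk : ∀ k, K ≤ k → 0 ≤ C * φ (Δ k) := fun k hk =>
    mul_nonneg hC (hφ _ ⟨hΔ k, hΔη k hk⟩)
  have hball : ∀ k, K ≤ k → ‖x k - x K‖ ≤ C * φ (Δ K) - C * φ (Δ k) → x k ∈ U := by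
    intro k hk h
    refine hrU ?_
    have h1 := hφk k hk
    have h2 := (hN K hK).2
    rw [Metric.mem_ball]
    have h3 := dist_triangle (x k) (x K) xbar
    rw [dist_eq_norm (x k) (x K)] at h3
    linarith
  -- The telescoped bound keeps `x k` within `r / 2` of `x K`, hence in `U`, which is what permits
  -- the next step estimate.
  have hin : ∀ k, K ≤ k → ‖x k - x K‖ ≤ C * φ (Δ K) - C * φ (Δ k) := by
    intro k hk
    induction k, hk using Nat.le_induction with
    | base => simp
    | succ k hk ih =>
      have h1 := hstep k (hball k hk ih) (hΔη k hk) (hΔη _ (by omega))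
      have h2 := norm_sub_le_norm_sub_add_norm_sub (x (k + 1)) (x k) (x K)
      linarith
  have hU' : ∀ k, K ≤ k → x k ∈ U := fun k hk => hball k hk (hin k hk)
  have htail : ∀ k, K ≤ k → ∀ m, k ≤ m → ‖x m - x k‖ ≤ C * φ (Δ k) - C * φ (Δ m) := by
    intro k hk m hm
    induction m, hm using Nat.le_induction with
    | base => simp
    | succ m hm ih =>
      have h1 := hstep m (hU' m (hk.trans hm)) (hΔη m (hk.trans hm)) (hΔη _ (by omega))
      have h2 := norm_sub_le_norm_sub_add_norm_sub (x (m + 1)) (x m) (x k)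
      linarith
  have hrate : ∀ k, K ≤ k → ‖x k - xbar‖ ≤ C * φ (Δ k) := by
    intro k hk
    refine le_of_forall_pos_le_add fun e he => ?_
    obtain ⟨m, hm, hxm⟩ := frequently_atTop.1
      (hxbar.frequently (Metric.ball_mem_nhds xbar he)) k
    have h1 := htail k hk m hm
    have h2 := hφk m (hk.trans hm)
    rw [dist_eq_norm] at hxm
    have h3 := norm_sub_le_norm_sub_add_norm_sub (x k) (x m) xbar
    rw [norm_sub_rev (x k) (x m)] at h3
    linarith
  constructor
  · rw [tendsto_iff_norm_sub_tendsto_zero]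
    refine squeeze_zero' (Eventually.of_forall fun _ => norm_nonneg _) ?_ hlim
    filter_upwards [eventually_ge_atTop K] with k hk using hrate k hk
  · filter_upwards [eventually_ge_atTop K] with k hk using ⟨hU' k hk, hΔη k hk, hrate k hk⟩

/-- The primitive of `1 / ψ` is a desingularizing function. -/
lemma exists_desingularizing {ψ : ℝ → ℝ} {η : ℝ} (hη : 0 < η)
    (hpos : ∀ t ∈ Set.Ioo 0 η, 0 < ψ t) (hmono : MonotoneOn ψ (Set.Ioo 0 η))
    (hint : IntegrableOn (fun t => 1 / ψ t) (Set.Ioo 0 η)) :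
    ∃ φ : ℝ → ℝ, (∀ t ∈ Set.Ioo 0 η, 0 ≤ φ t) ∧ Tendsto φ (𝓝[>] 0) (𝓝 0) ∧
      ∀ s t, 0 < t → t ≤ s → s < η → (s - t) / ψ s ≤ φ s - φ t := by
  have hint' : IntervalIntegrable (fun t => 1 / ψ t) volume 0 η := by
    rwa [intervalIntegrable_iff_integrableOn_Ioo_of_le hη.le]
  have hsub : ∀ a b, 0 ≤ a → a ≤ η → 0 ≤ b → b ≤ η →
      IntervalIntegrable (fun t => 1 / ψ t) volume a b := by
    intro a b ha ha' hb hb'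
    refine hint'.mono_set ?_
    rw [Set.uIcc_of_le hη.le]
    exact Set.uIcc_subset_Icc ⟨ha, ha'⟩ ⟨hb, hb'⟩
  refine ⟨fun t => ∫ u in (0 : ℝ)..t, 1 / ψ u, fun t ht => ?_, ?_, fun s t ht hts hs => ?_⟩
  · simp only
    rw [intervalIntegral.integral_of_le ht.1.le]
    exact setIntegral_nonneg measurableSet_Ioc fun u hu =>
      (one_div_pos.2 (hpos u ⟨hu.1, hu.2.trans_lt ht.2⟩)).le
  · have hcont := intervalIntegral.continuousOn_primitive_interval' hint'
      (a := 0) Set.left_mem_uIcc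
    have h0 := hcont 0 Set.left_mem_uIcc
    rw [Set.uIcc_of_le hη.le] at h0
    have h1 := h0.tendsto
    rw [intervalIntegral.integral_same] at h1
    refine h1.mono_left ?_
    rw [nhdsWithin_le_iff]
    exact mem_of_superset (Ioo_mem_nhdsGT hη) Set.Ioo_subset_Icc_self
  · have hs0 : 0 < s := ht.trans_le hts
    simp only
    rw [intervalIntegral.integral_interval_sub_left (hsub _ _ le_rfl hη.le hs0.le hs.le)
      (hsub _ _ le_rfl hη.le ht.le (hts.trans hs.le))]
    -- As `ψ` is nondecreasing, `1 / ψ` is at least `1 / ψ s` on `[t, s]`.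
    have h1 : ∫ _ in t..s, 1 / ψ s = (s - t) / ψ s := by
      rw [intervalIntegral.integral_const, smul_eq_mul, mul_one_div]
    rw [← h1]
    refine intervalIntegral.integral_mono_on hts intervalIntegrable_const
      (hsub _ _ ht.le (hts.trans hs.le) hs0.le hs.le) fun u hu => ?_
    have hu' : u ∈ Set.Ioo 0 η := ⟨ht.trans_le hu.1, hu.2.trans_lt hs⟩
    exact one_div_le_one_div_of_le (hpos u hu') (hmono hu' ⟨hs0, hs⟩ hu.2)

/-- The convex function `s ↦ s ^ (-a)` lies above its tangent at `t`. -/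
lemma rpow_tangent_le {a s t : ℝ} (ha : 0 ≤ a) (hs : 0 < s) (ht : 0 < t) :
    t ^ (-a) + a * ((t - s) / t ^ (a + 1)) ≤ s ^ (-a) := by
  have h1 : 1 - a * (s / t - 1) ≤ (s / t) ^ (-a) := by
    rw [Real.rpow_def_of_pos (div_pos hs ht)]
    have h2 := Real.log_le_sub_one_of_pos (div_pos hs ht)
    have h3 := Real.add_one_le_exp (Real.log (s / t) * -a)
    nlinarith
  rw [Real.div_rpow hs.le ht.le, le_div_iff₀ (Real.rpow_pos_of_pos ht _)] at h1
  refine le_of_eq_of_le ?_ h1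
  rw [Real.rpow_add ht, Real.rpow_neg ht.le, Real.rpow_one]
  have := (Real.rpow_pos_of_pos ht a).ne'
  field_simp
  ring

/-- Concavity of the explicit primitive `t ^ (1 - q) / (M * (1 - q))` of `1 / (M * t ^ q)`, by
Bernoulli's inequality for `t / s`. -/
lemma rpow_desingularizing {M q : ℝ} (hM : 0 < M) (hq0 : 0 < q) (hq1 : q < 1) {s t : ℝ}
    (ht : 0 < t) (hs : 0 < s) :
    (s - t) / (M * s ^ q) ≤ s ^ (1 - q) / (M * (1 - q)) - t ^ (1 - q) / (M * (1 - q)) := by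
  have hq : 0 < 1 - q := by linarith
  have h1 : (t / s) ^ (1 - q) ≤ 1 + (1 - q) * (t / s - 1) := by
    have := rpow_one_add_le_one_add_mul_self (s := t / s - 1) (p := 1 - q)
      (by linarith [div_pos ht hs]) hq.le (by linarith)
    rwa [add_sub_cancel] at this
  rw [Real.div_rpow ht.le hs.le, div_le_iff₀ (Real.rpow_pos_of_pos hs _)] at h1
  have h2 : s ^ q = s / s ^ (1 - q) := by
    rw [Real.rpow_sub hs, Real.rpow_one]
    have := (Real.rpow_pos_of_pos hs q).ne'
    field_simp
  have h3 := Real.rpow_pos_of_pos hs (1 - q)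
  rw [h2, ← sub_div, div_le_div_iff₀ (by positivity) (by positivity)]
  have h4 : (s - t) * (M * (1 - q)) = (1 - q) * (1 - t / s) * s ^ (1 - q) *
      (M * (s / s ^ (1 - q))) := by
    field_simp
  rw [h4]
  gcongr
  linarith

lemma isBigO_pow_of_le_mul {Δ : ℕ → ℝ} (hΔ : ∀ k, 0 < Δ k) {κ : ℝ} (hκ : 0 < κ)
    (h : ∀ᶠ k in atTop, κ * Δ k ≤ Δ k - Δ (k + 1)) :
    ∃ ρ : ℝ, 0 < ρ ∧ ρ < 1 ∧ Δ =O[atTop] fun k => ρ ^ k := by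
  obtain ⟨K, hK⟩ := eventually_atTop.1 h
  -- Positivity of `Δ (K + 1)` forces `κ < 1`.
  have hρ : 0 < 1 - κ := by
    have h1 := hK K le_rfl
    have h2 := hΔ (K + 1)
    refine pos_of_mul_pos_left (b := Δ K) ?_ (hΔ K).le
    linarith
  refine ⟨1 - κ, hρ, by linarith, IsBigO.of_bound (Δ K / (1 - κ) ^ K) ?_⟩
  filter_upwards [eventually_ge_atTop K] with k hk
  rw [Real.norm_of_nonneg (hΔ k).le, Real.norm_of_nonneg (by positivity)]
  induction k, hk using Nat.le_induction with
  | base => rw [div_mul_cancel₀ _ (by positivity)]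
  | succ k hk ih =>
    have h1 := hK k hk
    have h2 := mul_le_mul_of_nonneg_left ih hρ.le
    rw [pow_succ]
    linarith

/-- By `rpow_tangent_le`, `Δ k ^ (-a)` eventually grows by at least `a * κ` per step, hence at least
linearly in `k`. -/
lemma isBigO_rpow_of_le_rpow {Δ : ℕ → ℝ} (hΔ : ∀ k, 0 < Δ k) {κ a : ℝ} (hκ : 0 < κ)
    (ha : 0 < a) (h : ∀ᶠ k in atTop, κ * Δ k ^ (a + 1) ≤ Δ k - Δ (k + 1)) :
    Δ =O[atTop] fun k => (k : ℝ) ^ (-(1 / a)) := by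
  obtain ⟨K, hK⟩ := eventually_atTop.1 h
  have hpos : ∀ k, 0 < Δ k ^ (-a) := fun k => Real.rpow_pos_of_pos (hΔ k) _
  have hlow : ∀ k, K ≤ k → a * κ * ((k : ℝ) - K) ≤ Δ k ^ (-a) := by
    intro k hk
    induction k, hk using Nat.le_induction with
    | base => simpa using (hpos K).le
    | succ k hk ih =>
      have h1 := rpow_tangent_le ha.le (hΔ (k + 1)) (hΔ k)
      have h2 : κ ≤ (Δ k - Δ (k + 1)) / Δ k ^ (a + 1) := by
        rw [le_div_iff₀ (Real.rpow_pos_of_pos (hΔ k) _)]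
        exact hK k hk
      have h3 := mul_le_mul_of_nonneg_left h2 ha.le
      push_cast
      linarith
  refine IsBigO.of_bound ((a * κ / 2) ^ (-(1 / a))) ?_
  -- From here on `k - K ≥ k / 2`, whence the constant `a * κ / 2`.
  filter_upwards [eventually_ge_atTop (2 * K + 1)] with k hk
  have hk' : (2 * K + 1 : ℝ) ≤ k := by exact_mod_cast hk
  have hk0 : (0 : ℝ) < k := by
    have : (0 : ℝ) ≤ K := K.cast_nonneg
    linarith
  rw [Real.norm_of_nonneg (hΔ k).le, Real.norm_of_nonneg (by positivity),
    ← Real.mul_rpow (by positivity) hk0.le]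
  have h1 : a * κ / 2 * k ≤ Δ k ^ (-a) := by
    refine le_trans ?_ (hlow k (by omega))
    have : 0 < a * κ := mul_pos ha hκ
    nlinarith
  have h2 : Δ k = (Δ k ^ (-a)) ^ (-(1 / a)) := by
    rw [← Real.rpow_mul (hΔ k).le, neg_mul_neg, mul_one_div_cancel ha.ne', Real.rpow_one]
  nth_rw 1 [h2]
  refine Real.rpow_le_rpow_of_nonpos (by positivity) h1 ?_
  have : 0 < 1 / a := by positivity
  linarith

end Desingularization

/-! ### Convergence and rates under the KL property -/

section Convergence

variable {n : ℕ} {g : E n → EReal} {lam θ μ : ℝ} {x p : ℕ → E n} {ε : ℕ → ℝ} {i : ℕ → ℕ}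

/-- The step dominates the gradient of the envelope, and its square is dominated by the decrease
of the envelope. -/
lemma IsGenerated.exists_step_bounds (h : IsGenerated g lam θ μ x p ε i) (hg : Proper g)
    (hc : ConvexFun g) (hlam : 0 < lam) (hθ : 0 < θ) (hμ : 2 < μ) (hε : 0 < ε 0) :
    ∃ β : ℝ, 0 < β ∧ ∀ k, 0 < ‖x (k + 1) - x k‖ ∧
      ‖gradient (moreauEnvelope lam g) (x k)‖ ≤ 2 / lam * ‖x (k + 1) - x k‖ ∧
      β * ‖x (k + 1) - x k‖ ^ 2 ≤
        moreauEnvelope lam g (x k) - moreauEnvelope lam g (x (k + 1)) := by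
  have h3 : 1 / μ < 1 / 2 := one_div_lt_one_div_of_lt two_pos hμ
  have h4 : 0 < 1 / 2 - 1 / μ := by linarith
  refine ⟨1 / lam * (1 / 2 - 1 / μ), by positivity, fun k => ?_⟩
  obtain ⟨h1, -, h2, z, hz, hxz⟩ := h.descent hg hc hlam hθ hμ hε k
  refine ⟨h1, ?_, by linarith⟩
  rw [(hasGradientAt_moreauEnvelope hg hc hlam hz).gradient, norm_smul,
    Real.norm_of_nonneg (by positivity)]
  calc 1 / lam * ‖x k - z‖ ≤ 1 / lam * (2 * ‖x (k + 1) - x k‖) := by gcongr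
    _ = 2 / lam * ‖x (k + 1) - x k‖ := by ring

/-- Convergence and rate in terms of a desingularizing function. -/
lemma IsGenerated.tendsto_of_desingularizing (h : IsGenerated g lam θ μ x p ε i) (hg : Proper g)
    (hlsc : LowerSemicontinuous g) (hc : ConvexFun g) (hlam : 0 < lam) (hθ : 0 < θ) (hμ : 2 < μ)
    (hε : 0 < ε 0) {xbar : E n} (hxbar : MapClusterPt xbar atTop x) {ψ φ : ℝ → ℝ} {η : ℝ}
    (hη : 0 < η) {U : Set (E n)} (hU : U ∈ 𝓝 xbar) (hψ : ∀ t ∈ Set.Ioo 0 η, 0 < ψ t)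
    (hKL : ∀ y ∈ U, moreauEnvelope lam g xbar < moreauEnvelope lam g y →
      moreauEnvelope lam g y < moreauEnvelope lam g xbar + η →
      ψ (moreauEnvelope lam g y - moreauEnvelope lam g xbar) ≤
        ‖gradient (moreauEnvelope lam g) y‖)
    (hφ : ∀ t ∈ Set.Ioo 0 η, 0 ≤ φ t) (hφ0 : Tendsto φ (𝓝[>] 0) (𝓝 0))
    (hφψ : ∀ s t, 0 < t → t ≤ s → s < η → (s - t) / ψ s ≤ φ s - φ t) :
    ∃ Δ : ℕ → ℝ, (∀ k, 0 < Δ k) ∧ Tendsto Δ atTop (𝓝 0) ∧ Tendsto x atTop (𝓝 xbar) ∧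
      (∃ C, ∀ᶠ k in atTop, ‖x k - xbar‖ ≤ C * φ (Δ k)) ∧
      ∃ κ > 0, ∀ᶠ k in atTop, Δ k < η ∧ κ * ψ (Δ k) ^ 2 ≤ Δ k - Δ (k + 1) := by
  obtain ⟨hΔ, hΔ0⟩ := h.tendsto_envelope hg hlsc hc hlam hθ hμ hε hxbar
  obtain ⟨β, hβ, hstep⟩ := h.exists_step_bounds hg hc hlam hθ hμ hε
  set Δ : ℕ → ℝ := fun k => moreauEnvelope lam g (x k) - moreauEnvelope lam g xbar with hΔdef
  have hdec : ∀ k, β * ‖x (k + 1) - x k‖ ^ 2 ≤ Δ k - Δ (k + 1) := by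
    intro k
    have := (hstep k).2.2
    simp only [hΔdef]
    linarith
  have hψle : ∀ k, x k ∈ U → Δ k < η → ψ (Δ k) ≤ 2 / lam * ‖x (k + 1) - x k‖ := by
    intro k hk hk'
    have h1 := hΔ k
    simp only [hΔdef] at hk'
    exact (hKL _ hk (by linarith) (by linarith)).trans (hstep k).2.1
  have hmain := eventually_dist_le_of_desingularized hxbar hΔ hΔ0 hη
    (C := 2 / (lam * β)) (by positivity) hφ hφ0 hU ?_
  · refine ⟨Δ, hΔ, hΔ0, hmain.1, ⟨2 / (lam * β), hmain.2.mono fun k hk => hk.2.2⟩,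
      β * (lam / 2) ^ 2, by positivity, hmain.2.mono fun k hk => ⟨hk.2.1, ?_⟩⟩
    refine le_trans ?_ (hdec k)
    rw [mul_assoc, ← mul_pow]
    have h1 := hψ _ ⟨hΔ k, hk.2.1⟩
    gcongr
    calc lam / 2 * ψ (Δ k) ≤ lam / 2 * (2 / lam * ‖x (k + 1) - x k‖) := by
          gcongr; exact hψle k hk.1 hk.2.1
      _ = ‖x (k + 1) - x k‖ := by field_simp
  · intro k hk hk1 _
    have hd := (hstep k).1
    have h1 := hψ _ ⟨hΔ k, hk1⟩
    have hle : Δ (k + 1) ≤ Δ k := by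
      have : 0 ≤ β * ‖x (k + 1) - x k‖ ^ 2 := by positivity
      linarith [hdec k]
    have h2 := hφψ _ _ (hΔ (k + 1)) hle hk1
    have h3 : lam * β / 2 * ‖x (k + 1) - x k‖ ≤ (Δ k - Δ (k + 1)) / ψ (Δ k) := by
      rw [le_div_iff₀ h1]
      refine le_trans ?_ (hdec k)
      calc lam * β / 2 * ‖x (k + 1) - x k‖ * ψ (Δ k)
          ≤ lam * β / 2 * ‖x (k + 1) - x k‖ * (2 / lam * ‖x (k + 1) - x k‖) := by
            gcongr; exact hψle k hk hk1
        _ = β * ‖x (k + 1) - x k‖ ^ 2 := by field_simp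
    calc ‖x (k + 1) - x k‖ = 2 / (lam * β) * (lam * β / 2 * ‖x (k + 1) - x k‖) := by field_simp
      _ ≤ 2 / (lam * β) * (φ (Δ k) - φ (Δ (k + 1))) := by gcongr; exact h3.trans h2

lemma IsGenerated.tendsto_of_klProperty (h : IsGenerated g lam θ μ x p ε i) (hg : Proper g)
    (hlsc : LowerSemicontinuous g) (hc : ConvexFun g) (hlam : 0 < lam) (hθ : 0 < θ) (hμ : 2 < μ)
    (hε : 0 < ε 0) {xbar : E n} (hxbar : MapClusterPt xbar atTop x)
    (hKL : KLProperty (moreauEnvelope lam g) xbar) : Tendsto x atTop (𝓝 xbar) := by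
  obtain ⟨ψ, η, hη, U, hU, hψ, hmono, hint, hineq⟩ := hKL
  obtain ⟨φ, hφ, hφ0, hφψ⟩ := exists_desingularizing hη hψ hmono hint
  obtain ⟨_, _, _, hx, _⟩ := h.tendsto_of_desingularizing hg hlsc hc hlam hθ hμ hε hxbar hη hU hψ
    hineq hφ hφ0 hφψ
  exact hx

lemma IsGenerated.rates (h : IsGenerated g lam θ μ x p ε i) (hg : Proper g)
    (hlsc : LowerSemicontinuous g) (hc : ConvexFun g) (hlam : 0 < lam) (hθ : 0 < θ) (hμ : 2 < μ)
    (hε : 0 < ε 0) {xbar : E n} (hxbar : MapClusterPt xbar atTop x) {M q : ℝ} (hM : 0 < M)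
    (hq0 : 0 < q) (hq1 : q < 1)
    (hKL : KLPropertyWith (moreauEnvelope lam g) xbar (fun t => M * t ^ q)) :
    (q ≤ 1 / 2 → ConvergesLinearly x xbar) ∧
    (1 / 2 < q → (fun k => ‖x k - xbar‖) =O[atTop]
      (fun k : ℕ => (k : ℝ) ^ (-((1 - q) / (2 * q - 1))))) := by
  obtain ⟨η, hη, U, hU, hψ, -, -, hineq⟩ := hKL
  have hq : 0 < 1 - q := by linarith
  have hφ0 : Tendsto (fun t : ℝ => t ^ (1 - q) / (M * (1 - q))) (𝓝[>] 0) (𝓝 0) := by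
    have h1 := ((Real.continuous_rpow_const hq.le).div_const (M * (1 - q))).tendsto 0
    rw [Real.zero_rpow hq.ne', zero_div] at h1
    exact h1.mono_left nhdsWithin_le_nhds
  obtain ⟨Δ, hΔ, hΔ0, -, ⟨C, hC⟩, κ, hκ, hdec⟩ :=
    h.tendsto_of_desingularizing hg hlsc hc hlam hθ hμ hε hxbar hη hU hψ hineq
      (φ := fun t => t ^ (1 - q) / (M * (1 - q)))
      (fun t ht => div_nonneg (Real.rpow_nonneg ht.1.le _) (by positivity)) hφ0
      (fun s t ht hts _ => rpow_desingularizing hM hq0 hq1 ht (ht.trans_le hts))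
  have hdec' : ∀ᶠ k in atTop, κ * M ^ 2 * Δ k ^ (2 * q) ≤ Δ k - Δ (k + 1) := by
    filter_upwards [hdec] with k hk
    refine le_of_eq_of_le ?_ hk.2
    rw [mul_pow, mul_comm 2 q, Real.rpow_mul (hΔ k).le, Real.rpow_two, mul_assoc]
  have hbigO : (fun k => ‖x k - xbar‖) =O[atTop] fun k => Δ k ^ (1 - q) := by
    refine IsBigO.of_bound (C / (M * (1 - q))) (hC.mono fun k hk => ?_)
    rw [norm_norm, Real.norm_of_nonneg (Real.rpow_nonneg (hΔ k).le _)]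
    refine hk.trans (le_of_eq ?_)
    ring
  constructor
  · intro hq2
    -- Once `Δ k < 1`, `2 * q ≤ 1` gives `Δ k ≤ Δ k ^ (2 * q)`, so the recursion is geometric.
    obtain ⟨ρ, hρ0, hρ1, hΔρ⟩ := isBigO_pow_of_le_mul hΔ (κ := κ * M ^ 2) (by positivity) (by
      filter_upwards [hdec', hΔ0.eventually_lt_const one_pos] with k hk hk1
      refine le_trans ?_ hk
      gcongr
      calc Δ k = Δ k ^ (1 : ℝ) := (Real.rpow_one _).symm
        _ ≤ Δ k ^ (2 * q) :=
          Real.rpow_le_rpow_of_exponent_ge (hΔ k) hk1.le (by linarith))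
    have h1 := hbigO.trans
      (hΔρ.rpow hq.le (Eventually.of_forall fun k => (pow_pos hρ0 k).le))
    -- The comparison sequence never vanishes, so one constant serves every `k`.
    obtain ⟨D, -, hD⟩ := bound_of_isBigO_nat_atTop h1
    refine ⟨ρ ^ (1 - q), Real.rpow_pos_of_pos hρ0 _, Real.rpow_lt_one hρ0.le hρ1 hq, D, fun k => ?_⟩
    have hpos : 0 < (ρ ^ k) ^ (1 - q) := Real.rpow_pos_of_pos (pow_pos hρ0 k) _
    have h2 := hD (x := k) hpos.ne'
    rw [norm_norm, Real.norm_of_nonneg hpos.le] at h2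
    rwa [← Real.rpow_natCast, ← Real.rpow_mul hρ0.le, mul_comm (1 - q), Real.rpow_mul hρ0.le,
      Real.rpow_natCast]
  · intro hq2
    have ha : 0 < 2 * q - 1 := by linarith
    -- Here `a = 2 * q - 1`, so that `a + 1 = 2 * q`.
    have h1 := isBigO_rpow_of_le_rpow hΔ (κ := κ * M ^ 2) (by positivity) ha
      (by simpa using hdec')
    have h2 := hbigO.trans
      (h1.rpow hq.le (Eventually.of_forall fun k => Real.rpow_nonneg k.cast_nonneg _))
    refine h2.congr_right fun k => ?_
    rw [← Real.rpow_mul k.cast_nonneg]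
    congr 1
    ring

lemma exists_mapClusterPt_of_not_tendsto_norm (h : ¬ Tendsto (fun k => ‖x k‖) atTop atTop) :
    ∃ xbar, MapClusterPt xbar atTop x := by
  rw [tendsto_atTop] at h
  push Not at h
  obtain ⟨R, hR⟩ := h
  obtain ⟨xbar, -, hxbar⟩ := (isCompact_closedBall (0 : E n) R).exists_mapClusterPt_of_frequently
    (l := atTop) (f := x) (hR.mono fun k hk => by
      rw [mem_closedBall_zero_iff]; exact hk.le)
  exact ⟨xbar, hxbar⟩

end Convergence

end GIPPM

theorem mainTheorem3 {n : ℕ} (g : GIPPM.E n → EReal)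
    (hg_proper : GIPPM.Proper g) (hg_lsc : LowerSemicontinuous g) (hg_convex : GIPPM.ConvexFun g)
    (lam θ μ : ℝ) (hlam : 0 < lam) (hθ_pos : 0 < θ) (hθ_lt : θ < 1) (hμ : 2 < μ)
    (x p : ℕ → GIPPM.E n) (ε : ℕ → ℝ) (i : ℕ → ℕ) (hε : 0 < ε 0)
    (halg : GIPPM.IsGenerated g lam θ μ x p ε i)
    (hx : ∀ k, (0 : GIPPM.E n) ∉ GIPPM.subdifferential g (x k)) :
    Tendsto (fun k => ‖x k‖) atTop atTop ∨
      (((∀ xbar, MapClusterPt xbar atTop x → ∀ y, g xbar ≤ g y) ∧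
          Tendsto (fun k => ‖x k - p k‖) atTop (𝓝 0) ∧ Tendsto ε atTop (𝓝 0)) ∧
        (∀ xbar, MapClusterPt xbar atTop x →
          GIPPM.KLProperty (GIPPM.moreauEnvelope lam g) xbar → Tendsto x atTop (𝓝 xbar)) ∧
        (∀ xbar, MapClusterPt xbar atTop x → ∀ M q : ℝ, 0 < M → 0 < q → q < 1 →
          GIPPM.KLPropertyWith (GIPPM.moreauEnvelope lam g) xbar (fun t => M * t ^ q) →
            (q ≤ 1 / 2 → GIPPM.ConvergesLinearly x xbar) ∧
            (1 / 2 < q → (fun k => ‖x k - xbar‖) =O[atTop]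
              (fun k : ℕ => (k : ℝ) ^ (-((1 - q) / (2 * q - 1))))))) := by
  refine or_iff_not_imp_left.2 fun hnot => ?_
  obtain ⟨x₀, hx₀⟩ := GIPPM.exists_mapClusterPt_of_not_tendsto_norm hnot
  have hstep := halg.tendsto_step hg_proper hg_convex hlam hθ_pos hμ hε hx₀
  refine ⟨⟨fun xbar hxbar =>
    halg.isMinimizer hg_proper hg_lsc hg_convex hlam hθ_pos hμ hε hxbar, ?_, ?_⟩,
    fun xbar hxbar =>
      halg.tendsto_of_klProperty hg_proper hg_lsc hg_convex hlam hθ_pos hμ hε hxbar,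
    fun xbar hxbar M q hM hq0 hq1 =>
      halg.rates hg_proper hg_lsc hg_convex hlam hθ_pos hμ hε hxbar hM hq0 hq1⟩
  · simpa only [halg.iterate_update, norm_sub_rev] using hstep
  -- Step `k` controls the updated error `ε (k + 1)`, hence the shift.
  · rw [← tendsto_add_atTop_iff_nat 1]
    have hpos : 0 < lam * μ := by positivity
    refine squeeze_zero (fun k => (halg.error_pos hθ_pos hε (k + 1)).le) (fun k => ?_)
      (by simpa using hstep.div_const (lam * μ))
    rw [le_div_iff₀ hpos, mul_comm]
    exact (halg.descent hg_proper hg_convex hlam hθ_pos hμ hε k).2.1
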